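/- All graphs are simple, connected and non-empty (but possibly infinite), and every edge has length $1$; a graph is regarded as a metric graph, i.e. its points are the vertices and the interior points of the edges, and the distance is the length of a shortest path ($\infty$ between different connected components). A graph is trivial if it has a single vertex, and bounded if its diameter as a metric graph is finite. A geodesic metric space is $\delta$-hyperbolic if each side of every geodesic triangle is contained in the $\delta$-neighborhood of the union of the two other sides; a (possibly disconnected) graph is hyperbolic if there is a $\delta \ge 0$ such that all its connected components are $\delta$-hyperbolic. The direct product $G_1\times G_2$ has vertex set $V(G_1)\times V(G_2)$, and $(u_1,v_1)$, $(u_2,v_2)$ are adjacent if and only if $u_1u_2\in E(G_1)$ and $v_1v_2\in E(G_2)$. Theorem. Let $G_1$ be a graph without odd cycles and let $G_2$ be a non-trivial bounded graph without odd cycles. Then $G_1\times G_2$ is hyperbolic if and only if $G_1$ is hyperbolic. Moreover, if $G_1$ is non-trivial, then $G_1\times G_2$ has exactly two connected components. -/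

import Mathlib

open scoped ENNReal

/-! ## The direct product of graphs -/

/-- The direct (tensor, categorical) product of two simple graphs: `(u₁, v₁)` and `(u₂, v₂)` are
adjacent iff `u₁` is adjacent to `u₂` and `v₁` is adjacent to `v₂`. -/
def SimpleGraph.directProduct {V W : Type*} (G : SimpleGraph V) (H : SimpleGraph W) :
    SimpleGraph (V × W) where
  Adj x y := G.Adj x.1 y.1 ∧ H.Adj x.2 y.2
  symm := ⟨fun _ _ h => ⟨h.1.symm, h.2.symm⟩⟩
  loopless := ⟨fun _ h => G.loopless.irrefl _ h.1⟩

/-! ## A graph as a metric graph -/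

/-- The points of the metric graph of `G`, in barycentric coordinates: the basis vector of a
vertex `u` represents that vertex, and the segment between the basis vectors of two adjacent
vertices represents the edge joining them. -/
@[ext]
structure MetricGraph {V : Type*} (G : SimpleGraph V) where
  /-- the barycentric coordinates of the point -/
  coords : V →₀ ℝ
  exists_mem_segment : ∃ u v, (u = v ∨ G.Adj u v) ∧
    coords ∈ segment ℝ (Finsupp.single u (1 : ℝ)) (Finsupp.single v (1 : ℝ))

namespace MetricGraph

variable {V : Type*} {G : SimpleGraph V}

/-- The point `x` lies on the closed edge with end points `u` and `v`
(or is the vertex `u`, if `u = v`). -/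
def OnEdge (x : MetricGraph G) (u v : V) : Prop :=
  (u = v ∨ G.Adj u v) ∧
    x.coords ∈ segment ℝ (Finsupp.single u (1 : ℝ)) (Finsupp.single v (1 : ℝ))

/-- The vertex `u` is `x` itself or an end point of a closed edge that contains `x`. Then
`1 - x.coords u` is the length of the part of that edge between `x` and `u`. -/
def IsEnd (x : MetricGraph G) (u : V) : Prop := ∃ v, x.OnEdge u v

/-- The length of the piece of an edge between `x` and `y`, if there is a closed edge that
contains them both, and `∞` otherwise. -/
noncomputable def edgeDist (x y : MetricGraph G) : ℝ≥0∞ :=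
  ⨅ (u : V) (v : V) (_ : x.OnEdge u v ∧ y.OnEdge u v), ENNReal.ofReal |x.coords u - y.coords u|

/-- The minimal length of a path that goes from `x` to an end `a` of an edge containing `x`, then
along edges of `G` to an end `b` of an edge containing `y`, and then to `y`. -/
noncomputable def vertexDist (x y : MetricGraph G) : ℝ≥0∞ :=
  ⨅ (a : V) (b : V) (_ : x.IsEnd a ∧ y.IsEnd b),
    (ENNReal.ofReal (1 - x.coords a) + (G.edist a b : ℝ≥0∞) + ENNReal.ofReal (1 - y.coords b))

/-- The length of a shortest path from `x` to `y` in the metric graph of `G`, all of whose edges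
have length `1`; it is `∞` if `x` and `y` lie in different components. -/
noncomputable def pathDist (x y : MetricGraph G) : ℝ≥0∞ := min (edgeDist x y) (vertexDist x y)

/-! ### `pathDist` is an extended metric -/

lemma onEdge_iff_exists {x : MetricGraph G} {u v : V} : x.OnEdge u v ↔ (u = v ∨ G.Adj u v) ∧
    ∃ t : ℝ, 0 ≤ t ∧ t ≤ 1 ∧ x.coords = Finsupp.single u (1 - t) + Finsupp.single v t := by
  unfold OnEdge segment
  refine and_congr_right fun _ => ⟨?_, ?_⟩
  · rintro ⟨a, b, ha, hb, hab, h⟩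
    refine ⟨b, hb, by linarith, ?_⟩
    rw [← h, show 1 - b = a by linarith]
    simp
  · rintro ⟨t, h0, h1, h⟩
    exact ⟨1 - t, t, by linarith, h0, by ring, by rw [h]; simp⟩

lemma OnEdge.symm {x : MetricGraph G} {u v : V} (h : x.OnEdge u v) : x.OnEdge v u :=
  ⟨h.1.imp Eq.symm fun h => h.symm, by rw [segment_symm]; exact h.2⟩

lemma coords_nonneg (x : MetricGraph G) (a : V) : 0 ≤ x.coords a := by
  classical
  obtain ⟨u, v, h⟩ := x.exists_mem_segment
  obtain ⟨-, t, h0, h1, h⟩ := onEdge_iff_exists.1 h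
  rw [h]
  simp only [Finsupp.add_apply, Finsupp.single_apply]
  split_ifs <;> linarith

lemma coords_add_le (x : MetricGraph G) {a b : V} (hab : a ≠ b) :
    x.coords a + x.coords b ≤ 1 := by
  classical
  obtain ⟨u, v, h⟩ := x.exists_mem_segment
  obtain ⟨-, t, h0, h1, h⟩ := onEdge_iff_exists.1 h
  rw [h]
  simp only [Finsupp.add_apply, Finsupp.single_apply]
  split_ifs <;> first | linarith | (subst_vars; exact absurd rfl hab)

lemma coords_le_one (x : MetricGraph G) (a : V) : x.coords a ≤ 1 := by
  classical
  obtain ⟨u, v, h⟩ := x.exists_mem_segment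
  obtain ⟨-, t, h0, h1, h⟩ := onEdge_iff_exists.1 h
  rw [h]
  simp only [Finsupp.add_apply, Finsupp.single_apply]
  split_ifs <;> linarith

lemma OnEdge.eq_or_adj {x : MetricGraph G} {u v : V} (h : x.OnEdge u v) : u = v ∨ G.Adj u v := h.1

lemma OnEdge.add_eq {x : MetricGraph G} {u v : V} (h : x.OnEdge u v) (huv : u ≠ v) :
    x.coords u + x.coords v = 1 := by
  classical
  obtain ⟨-, t, h0, h1, h⟩ := onEdge_iff_exists.1 h
  rw [h]
  simp [huv, huv.symm]

lemma OnEdge.coords_self {x : MetricGraph G} {u : V} (h : x.OnEdge u u) : x.coords u = 1 := by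
  obtain ⟨-, t, h0, h1, h⟩ := onEdge_iff_exists.1 h
  rw [h]
  simp

lemma OnEdge.eq_zero {x : MetricGraph G} {u v w : V} (h : x.OnEdge u v) (hu : w ≠ u)
    (hv : w ≠ v) : x.coords w = 0 := by
  classical
  obtain ⟨-, t, h0, h1, h⟩ := onEdge_iff_exists.1 h
  rw [h]
  simp [hu.symm, hv.symm]

lemma OnEdge.isEnd {x : MetricGraph G} {u v : V} (h : x.OnEdge u v) : x.IsEnd u := ⟨v, h⟩

/-- A point on the edge `uv` is either the vertex `u`, or the vertex `v`, or every edge that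
contains it is the edge `uv`. -/
lemma OnEdge.cases {x : MetricGraph G} {u v a b : V} (h : x.OnEdge u v) (h' : x.OnEdge a b) :
    x.coords u = 1 ∨ x.coords v = 1 ∨ ((a = u ∧ b = v) ∨ (a = v ∧ b = u)) := by
  by_cases huv : u = v
  · subst huv; exact Or.inl h.coords_self
  by_cases h1 : x.coords u = 1
  · exact Or.inl h1
  by_cases h2 : x.coords v = 1
  · exact Or.inr (Or.inl h2)
  have hs := h.add_eq huv
  refine Or.inr (Or.inr ?_)
  have hu : u = a ∨ u = b := by
    by_contra! hc
    have := h'.eq_zero hc.1 hc.2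
    exact h2 (by linarith)
  have hv : v = a ∨ v = b := by
    by_contra! hc
    have := h'.eq_zero hc.1 hc.2
    exact h1 (by linarith)
  grind

/-- Two ends of a point are joined by a path through the point. -/
lemma IsEnd.edist_le {x : MetricGraph G} {a b : V} (ha : x.IsEnd a) (hb : x.IsEnd b) :
    (G.edist a b : ℝ≥0∞) ≤ ENNReal.ofReal (1 - x.coords a) + ENNReal.ofReal (1 - x.coords b) := by
  obtain ⟨a', ha⟩ := ha
  obtain ⟨b', hb⟩ := hb
  rw [← ENNReal.ofReal_add (by linarith [x.coords_le_one a]) (by linarith [x.coords_le_one b])]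
  by_cases hab : a = b
  · subst hab; simp
  -- the end `c` of value one is at distance at most one from every other end
  have key : ∀ c d d' : V, x.coords c = 1 → x.OnEdge d d' → c = d ∨ G.Adj c d := by
    intro c d d' hc hd
    by_cases hcd : c = d
    · exact Or.inl hcd
    · have hd'c : c = d' := by
        by_contra hne
        have := hd.eq_zero hcd hne
        linarith
      subst hd'c
      exact hd.symm.eq_or_adj
  have one : ∀ c d : V, c = d ∨ G.Adj c d → (G.edist c d : ℝ≥0∞) ≤ 1 := by
    intro c d h
    have h1 : G.edist c d ≤ 1 := SimpleGraph.edist_le_one_iff_adj_or_eq.2 h.symm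
    calc (G.edist c d : ℝ≥0∞) ≤ ((1 : ℕ∞) : ℝ≥0∞) := by exact_mod_cast h1
      _ = 1 := by simp
  have hle := x.coords_add_le hab
  have bound : ∀ _ : (a = b ∨ G.Adj a b), (G.edist a b : ℝ≥0∞) ≤
      ENNReal.ofReal (1 - x.coords a + (1 - x.coords b)) := fun h =>
    (one a b h).trans (by rw [← ENNReal.ofReal_one]; exact ENNReal.ofReal_le_ofReal (by linarith))
  rcases ha.cases hb with h | h | ⟨rfl, rfl⟩ | ⟨rfl, rfl⟩
  · exact bound (key a b b' h hb)
  · -- `x` is the vertex `a'`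
    by_cases hba : b = a'
    · subst hba; exact bound ha.eq_or_adj
    by_cases haa : a = a'
    · subst haa; exact bound (key a b b' h hb)
    have h1 := one _ _ (ha.eq_or_adj)
    have h2 := one _ _ (key a' b b' h hb)
    have ha0 : x.coords a = 0 := by
      have := ha.add_eq haa; have := x.coords_nonneg a; linarith
    have hb0 : x.coords b = 0 := by
      have := x.coords_add_le hba; have := x.coords_nonneg b; linarith
    have h3 : (G.edist a b : ℝ≥0∞) ≤ G.edist a a' + G.edist a' b := by
      exact_mod_cast SimpleGraph.edist_triangle (G := G)
    rw [ha0, hb0]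
    refine h3.trans ((add_le_add h1 h2).trans ?_)
    rw [show (1 : ℝ) - 0 + (1 - 0) = 2 by norm_num]
    norm_num
  · exact absurd rfl hab
  · exact bound ha.eq_or_adj

lemma edgeDist_le {x y : MetricGraph G} {u v : V} (hx : x.OnEdge u v) (hy : y.OnEdge u v) :
    edgeDist x y ≤ ENNReal.ofReal |x.coords u - y.coords u| :=
  iInf_le_of_le u (iInf_le_of_le v (iInf_le_of_le ⟨hx, hy⟩ le_rfl))

lemma vertexDist_le {x y : MetricGraph G} {a b : V} (hx : x.IsEnd a) (hy : y.IsEnd b) :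
    vertexDist x y ≤
      ENNReal.ofReal (1 - x.coords a) + (G.edist a b : ℝ≥0∞) + ENNReal.ofReal (1 - y.coords b) :=
  iInf_le_of_le a (iInf_le_of_le b (iInf_le_of_le ⟨hx, hy⟩ le_rfl))

lemma pathDist_self (x : MetricGraph G) : pathDist x x = 0 := by
  obtain ⟨u, v, h⟩ := x.exists_mem_segment
  refine le_antisymm ((min_le_left _ _).trans ((edgeDist_le h h).trans ?_)) bot_le
  simp

lemma edgeDist_comm (x y : MetricGraph G) : edgeDist x y = edgeDist y x := by
  unfold edgeDist
  simp only [abs_sub_comm, and_comm]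

lemma vertexDist_comm (x y : MetricGraph G) : vertexDist x y = vertexDist y x := by
  have h2 : ∀ x y : MetricGraph G, vertexDist x y ≤ vertexDist y x := fun x y =>
    le_iInf fun a => le_iInf fun b => le_iInf fun h => by
      refine (vertexDist_le h.2 h.1).trans (le_of_eq ?_)
      rw [SimpleGraph.edist_comm]; ring
  exact le_antisymm (h2 _ _) (h2 _ _)

lemma pathDist_comm (x y : MetricGraph G) : pathDist x y = pathDist y x := by
  rw [pathDist, pathDist, edgeDist_comm, vertexDist_comm]

lemma OnEdge.one_sub_le {x y : MetricGraph G} {u v : V} (hx : x.OnEdge u v) (hy : y.OnEdge u v) :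
    1 - x.coords u ≤ |x.coords u - y.coords u| + (1 - y.coords u) ∧
    1 - x.coords v ≤ |x.coords u - y.coords u| + (1 - y.coords v) := by
  have h1 := neg_abs_le (x.coords u - y.coords u)
  have h2 := le_abs_self (x.coords u - y.coords u)
  refine ⟨by linarith, ?_⟩
  by_cases huv : u = v
  · subst huv; linarith
  · have := hx.add_eq huv; have := hy.add_eq huv; linarith

/-- Moving along an edge to a vertex end, seen from an end of another point on the edge. -/
lemma OnEdge.exists_end {x y : MetricGraph G} {u v a : V} (hx : x.OnEdge u v) (hy : y.OnEdge u v)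
    (ha : y.IsEnd a) : ∃ c, x.IsEnd c ∧ ENNReal.ofReal (1 - x.coords c) + (G.edist c a : ℝ≥0∞) ≤
      ENNReal.ofReal |x.coords u - y.coords u| + ENNReal.ofReal (1 - y.coords a) := by
  obtain ⟨l1, l2⟩ := hx.one_sub_le hy
  have np : ∀ c, 0 ≤ 1 - y.coords c := fun c => by linarith [y.coords_le_one c]
  have e : ∀ c, y.IsEnd c → y.coords c = 1 →
      (G.edist c a : ℝ≥0∞) ≤ ENNReal.ofReal (1 - y.coords a) := fun c hc h => by
    simpa [h] using hc.edist_le ha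
  have ha' := ha
  obtain ⟨b, hb⟩ := ha
  rcases hy.cases hb with h | h | ⟨rfl, rfl⟩ | ⟨rfl, rfl⟩
  · exact ⟨u, hx.isEnd, add_le_add (ENNReal.ofReal_le_ofReal (by linarith)) (e u hy.isEnd h)⟩
  · exact ⟨v, hx.symm.isEnd,
      add_le_add (ENNReal.ofReal_le_ofReal (by linarith)) (e v hy.symm.isEnd h)⟩
  · refine ⟨a, hx.isEnd, ?_⟩
    rw [← ENNReal.ofReal_add (abs_nonneg _) (np _)]
    simpa using ENNReal.ofReal_le_ofReal l1
  · refine ⟨a, hx.symm.isEnd, ?_⟩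
    rw [← ENNReal.ofReal_add (abs_nonneg _) (np _)]
    simpa using ENNReal.ofReal_le_ofReal l2

lemma vertexDist_le_edge_add {x y z : MetricGraph G} :
    vertexDist x z ≤ edgeDist x y + vertexDist y z := by
  unfold edgeDist
  simp only [ENNReal.iInf_add]
  refine le_iInf fun u => le_iInf fun v => le_iInf fun h => ?_
  conv_rhs => unfold vertexDist
  simp only [ENNReal.add_iInf]
  refine le_iInf fun a => le_iInf fun b => le_iInf fun h' => ?_
  obtain ⟨c, hc, hle⟩ := h.1.exists_end h.2 h'.1
  refine (vertexDist_le hc h'.2).trans ?_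
  have h3 : (G.edist c b : ℝ≥0∞) ≤ G.edist c a + G.edist a b := by
    exact_mod_cast SimpleGraph.edist_triangle (G := G)
  calc _ ≤ ENNReal.ofReal (1 - x.coords c) + ((G.edist c a : ℝ≥0∞) + G.edist a b) +
        ENNReal.ofReal (1 - z.coords b) := by gcongr
    _ = (ENNReal.ofReal (1 - x.coords c) + (G.edist c a : ℝ≥0∞)) + G.edist a b +
        ENNReal.ofReal (1 - z.coords b) := by ring
    _ ≤ (ENNReal.ofReal |x.coords u - y.coords u| + ENNReal.ofReal (1 - y.coords a)) +
        G.edist a b + ENNReal.ofReal (1 - z.coords b) := by gcongr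
    _ = _ := by ring

lemma vertexDist_triangle {x y z : MetricGraph G} :
    vertexDist x z ≤ vertexDist x y + vertexDist y z := by
  conv_rhs => unfold vertexDist
  simp only [ENNReal.iInf_add]
  refine le_iInf fun a => le_iInf fun b => le_iInf fun h => ?_
  simp only [ENNReal.add_iInf]
  refine le_iInf fun c => le_iInf fun d => le_iInf fun h' => ?_
  refine (vertexDist_le h.1 h'.2).trans ?_
  have h3 : (G.edist a d : ℝ≥0∞) ≤ G.edist a b + (G.edist b c + G.edist c d) := by
    have h1 := SimpleGraph.edist_triangle (G := G) (u := a) (v := b) (w := d)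
    have h2 := SimpleGraph.edist_triangle (G := G) (u := b) (v := c) (w := d)
    exact_mod_cast h1.trans (add_le_add le_rfl h2)
  have h4 := h.2.edist_le h'.1
  calc _ ≤ ENNReal.ofReal (1 - x.coords a) + ((G.edist a b : ℝ≥0∞) + (G.edist b c + G.edist c d)) +
        ENNReal.ofReal (1 - z.coords d) := by gcongr
    _ ≤ ENNReal.ofReal (1 - x.coords a) + ((G.edist a b : ℝ≥0∞) +
        ((ENNReal.ofReal (1 - y.coords b) + ENNReal.ofReal (1 - y.coords c)) + G.edist c d)) +
        ENNReal.ofReal (1 - z.coords d) := by gcongr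
    _ = _ := by ring

lemma pathDist_le_edge_add_edge {x y z : MetricGraph G} :
    pathDist x z ≤ edgeDist x y + edgeDist y z := by
  unfold edgeDist
  simp only [ENNReal.iInf_add]
  refine le_iInf fun u => le_iInf fun v => le_iInf fun h => ?_
  simp only [ENNReal.add_iInf]
  refine le_iInf fun a => le_iInf fun b => le_iInf fun h' => ?_
  rw [← ENNReal.ofReal_add (abs_nonneg _) (abs_nonneg _)]
  -- the case that `y` is a common vertex of the two edges
  have vert : ∀ c, x.IsEnd c → z.IsEnd c →
      1 - x.coords c ≤ |x.coords u - y.coords u| → 1 - z.coords c ≤ |y.coords a - z.coords a| →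
      pathDist x z ≤
        ENNReal.ofReal (|x.coords u - y.coords u| + |y.coords a - z.coords a|) := by
    intro c hxc hzc h1 h2
    refine (min_le_right _ _).trans ((vertexDist_le hxc hzc).trans ?_)
    rw [SimpleGraph.edist_self, ENNReal.ofReal_add (abs_nonneg _) (abs_nonneg _)]
    simpa using add_le_add (ENNReal.ofReal_le_ofReal h1) (ENNReal.ofReal_le_ofReal h2)
  obtain ⟨l1, l2⟩ := h.1.one_sub_le h.2
  obtain ⟨m1, m2⟩ := h'.2.one_sub_le h'.1
  rw [abs_sub_comm (z.coords a)] at m1 m2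
  -- a vertex `c` equal to `y` is one of the ends `a`, `b`
  have hcz : ∀ c, y.coords c = 1 → c = a ∨ c = b := by
    intro c hc
    by_contra! hne
    have := h'.1.eq_zero hne.1 hne.2
    linarith
  rcases h.2.cases h'.1 with hu | hv | ⟨rfl, rfl⟩ | ⟨rfl, rfl⟩
  · rcases hcz u hu with rfl | rfl
    · exact vert u h.1.isEnd h'.2.isEnd (by linarith) (by linarith)
    · exact vert u h.1.isEnd h'.2.symm.isEnd (by linarith) (by linarith)
  · rcases hcz v hv with rfl | rfl
    · exact vert v h.1.symm.isEnd h'.2.isEnd (by linarith) (by linarith)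
    · exact vert v h.1.symm.isEnd h'.2.symm.isEnd (by linarith) (by linarith)
  · refine (min_le_left _ _).trans ((edgeDist_le h.1 h'.2).trans (ENNReal.ofReal_le_ofReal ?_))
    exact abs_sub_le _ _ _
  · refine (min_le_left _ _).trans ((edgeDist_le h.1.symm h'.2).trans
      (ENNReal.ofReal_le_ofReal ?_))
    refine (abs_sub_le _ (y.coords a) _).trans (add_le_add (le_of_eq ?_) le_rfl)
    by_cases hab : a = b
    · subst hab; rfl
    · have h1 := h.1.symm.add_eq hab
      have h2 := h'.1.add_eq hab
      rw [show x.coords a - y.coords a = -(x.coords b - y.coords b) by linarith, abs_neg]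

lemma pathDist_triangle (x y z : MetricGraph G) :
    pathDist x z ≤ pathDist x y + pathDist y z := by
  rcases min_choice (edgeDist x y) (vertexDist x y) with h1 | h1 <;>
  rcases min_choice (edgeDist y z) (vertexDist y z) with h2 | h2
  · conv_rhs => rw [pathDist, pathDist, h1, h2]
    exact pathDist_le_edge_add_edge
  · conv_rhs => rw [pathDist, pathDist, h1, h2]
    exact (min_le_right _ _).trans vertexDist_le_edge_add
  · conv_rhs => rw [pathDist, pathDist, h1, h2]
    rw [add_comm, edgeDist_comm, vertexDist_comm x y]
    refine (min_le_right _ _).trans ?_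
    rw [vertexDist_comm]
    exact vertexDist_le_edge_add
  · conv_rhs => rw [pathDist, pathDist, h1, h2]
    exact (min_le_right _ _).trans vertexDist_triangle

lemma abs_sub_le_pathDist (x y : MetricGraph G) (w : V) :
    ENNReal.ofReal |x.coords w - y.coords w| ≤ pathDist x y := by
  refine le_min (le_iInf fun u => le_iInf fun v => le_iInf fun h => ?_)
    (le_iInf fun a => le_iInf fun b => le_iInf fun h => ?_)
  · refine ENNReal.ofReal_le_ofReal ?_
    by_cases hu : w = u
    · rw [hu]
    by_cases hv : w = v
    · subst hv
      have h1 := h.1.add_eq (Ne.symm hu)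
      have h2 := h.2.add_eq (Ne.symm hu)
      rw [show x.coords w - y.coords w = -(x.coords u - y.coords u) by linarith, abs_neg]
    · rw [h.1.eq_zero hu hv, h.2.eq_zero hu hv]; simp
  · have hx0 := x.coords_nonneg w
    have hy0 := y.coords_nonneg w
    have hx1 := x.coords_le_one w
    have hy1 := y.coords_le_one w
    by_cases hab : a = b
    · subst hab
      rw [SimpleGraph.edist_self, ENat.toENNReal_zero, add_zero, ← ENNReal.ofReal_add
        (by linarith [x.coords_le_one a]) (by linarith [y.coords_le_one a])]
      refine ENNReal.ofReal_le_ofReal (abs_le.2 ?_)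
      by_cases hw : w = a
      · subst hw; constructor <;> linarith
      · have := x.coords_add_le hw
        have := y.coords_add_le hw
        have := x.coords_le_one a
        have := y.coords_le_one a
        constructor <;> linarith
    · have h1 : (1 : ℕ∞) ≤ G.edist a b := Order.one_le_iff_ne_zero.2 (by
        rw [Ne, SimpleGraph.edist_eq_zero_iff]; exact hab)
      have h2 : (1 : ℝ≥0∞) ≤ G.edist a b := by exact_mod_cast h1
      calc ENNReal.ofReal |x.coords w - y.coords w| ≤ ENNReal.ofReal 1 :=
            ENNReal.ofReal_le_ofReal (abs_le.2 ⟨by linarith, by linarith⟩)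
        _ ≤ G.edist a b := by simpa using h2
        _ ≤ _ := le_add_right le_add_self

/-- The metric graph of `G`, with the distance induced by shortest paths. -/
noncomputable instance : EMetricSpace (MetricGraph G) where
  edist := pathDist
  edist_self := pathDist_self
  edist_comm := pathDist_comm
  edist_triangle := pathDist_triangle
  eq_of_edist_eq_zero {x y} h := by
    ext w
    have h1 := (abs_sub_le_pathDist x y w).trans (le_of_eq h)
    have h2 := abs_nonpos_iff.1 (ENNReal.ofReal_eq_zero.1 (le_antisymm h1 bot_le))
    linarith

/-- The part of the metric graph of `G` that belongs to a connected component of `G`. -/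
def component (C : G.ConnectedComponent) : Set (MetricGraph G) :=
  {x | ∀ v, x.coords v ≠ 0 → G.connectedComponentMk v = C}

end MetricGraph

/-! ## Gromov hyperbolicity -/

/-- `S` is (the image of) a geodesic joining `x` and `y`. -/
def IsGeodesicSegment {X : Type*} [PseudoEMetricSpace X] (S : Set X) (x y : X) : Prop :=
  ∃ (l : ℝ) (γ : ℝ → X), 0 ≤ l ∧ γ 0 = x ∧ γ l = y ∧
    (∀ s ∈ Set.Icc 0 l, ∀ t ∈ Set.Icc 0 l, edist (γ s) (γ t) = ENNReal.ofReal |s - t|) ∧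
    S = γ '' Set.Icc 0 l

/-- The Rips condition: every side of every geodesic triangle is contained in the closed
`δ`-neighborhood of the union of the two other sides. -/
def IsDeltaHyperbolic (X : Type*) [PseudoEMetricSpace X] (δ : ℝ) : Prop :=
  ∀ (x y z : X) (A B C : Set X),
    IsGeodesicSegment A x y → IsGeodesicSegment B y z → IsGeodesicSegment C z x →
      A ⊆ Metric.cthickening δ (B ∪ C) ∧ B ⊆ Metric.cthickening δ (C ∪ A) ∧
        C ⊆ Metric.cthickening δ (A ∪ B)

namespace SimpleGraph

variable {V : Type*} (G : SimpleGraph V)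

/-- A graph is hyperbolic if for some `δ ≥ 0` all its connected components, as metric graphs, are
`δ`-hyperbolic. -/
def IsHyperbolic : Prop :=
  ∃ δ : ℝ, 0 ≤ δ ∧ ∀ C : G.ConnectedComponent, IsDeltaHyperbolic (MetricGraph.component C) δ

/-- A graph is bounded if its metric graph has finite diameter. -/
def IsBoundedGraph : Prop := Metric.ediam (Set.univ : Set (MetricGraph G)) < ⊤

/-- The graph has no cycle of odd length. -/
def NoOddCycle : Prop := ∀ (v : V) (c : G.Walk v v), c.IsCycle → ¬ Odd c.length

end SimpleGraph

/-! ### Graphs without odd cycles are two-colorable -/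

/-! The absence of odd cycles gives two-colorings `c` of the first factor and `d` of the second.
Each edge of the product flips both colors, so `c x.1 ^^ d x.2` is constant on components.
Conversely, two product vertices with the same value of this invariant are joined as follows:
traverse a shortest path in the first factor while the second coordinate oscillates along one edge,
then a shortest path in the second factor while the first coordinate oscillates. The invariant makes
the parities fit (`exists_edist_directProduct_le`). Hence there are exactly two components when both
factors are non-trivial.

The same walk shows that, within a component, the product distance exceeds the distance of the first
coordinates by at most the diameter of the second factor, while projection never increases distance.
So projection preserves distances up to an additive constant. In the other direction, oscillating
along a fixed edge embeds the first factor isometrically into the product.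

It remains to pull hyperbolicity back along maps with additive error
(`IsDeltaHyperbolic.of_rough_isometry`). Since the error is purely additive, the image of a geodesic
is almost between its end points, and thin triangles alone keep it near a true geodesic; no
stability theorem for quasi-geodesics is needed. `isDeltaHyperbolic_component_of_vertexMap` reduces
metric graphs to their vertices. -/

namespace SimpleGraph

/-- Passing to `bypass` only removes closed pieces of even length. Applied to a closed walk, whose
bypass is empty, this shows that all closed walks are even. -/
lemma NoOddCycle.even_length_add_length_bypass {V : Type*} [DecidableEq V] {G : SimpleGraph V}
    (hG : G.NoOddCycle) {u v : V} (p : G.Walk u v) : Even (p.length + p.bypass.length) := by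
  induction p with
  | nil => simp [Walk.bypass]
  | @cons u v w h q ih =>
    simp only [Walk.bypass]
    split_ifs with hs
    · have hlen : (q.bypass.takeUntil u hs).length + (q.bypass.dropUntil u hs).length =
          q.bypass.length := by
        rw [← Walk.length_append, Walk.take_spec]
      have hp : (q.bypass.takeUntil u hs).IsPath := q.bypass_isPath.takeUntil hs
      have hodd : Odd (q.bypass.takeUntil u hs).length := by
        -- The removed path from `v` back to `u` is either the edge `vu` itself, of length one, or
        -- closes up with that edge to a cycle, which is even.
        by_cases he : s(v, u) ∈ (q.bypass.takeUntil u hs).edges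
        · rw [hp.length_eq_one_of_mem_edges he]
          exact odd_one
        · have hc := hG u (Walk.cons h (q.bypass.takeUntil u hs))
            ((Walk.cons_isCycle_iff _ _).2 ⟨hp, by rwa [Sym2.eq_swap]⟩)
          rw [Walk.length_cons] at hc
          grind
      rw [Walk.length_cons]
      grind
    · simp only [Walk.length_cons]
      grind

lemma NoOddCycle.exists_coloring {V : Type*} {G : SimpleGraph V} (hG : G.NoOddCycle) :
    Nonempty (G.Coloring Bool) := by
  classical
  have h2 : G.Colorable 2 := two_colorable_iff_forall_loop_even.2 fun u w => by
    have h := hG.even_length_add_length_bypass w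
    rwa [Walk.length_eq_zero_iff.2 (Walk.isPath_iff_nil.1 w.bypass_isPath), add_zero] at h
  exact ⟨h2.toColoring (by simp)⟩

end SimpleGraph

/-! ### Hyperbolicity and rough isometric embeddings -/

section RoughIsometry

variable {X Y : Type*} [PseudoMetricSpace X] [PseudoMetricSpace Y]

lemma IsGeodesicSegment.exists_param {S : Set X} {a b : X} (h : IsGeodesicSegment S a b) :
    ∃ γ : ℝ → X, γ 0 = a ∧ γ (dist a b) = b ∧
      (∀ s ∈ Set.Icc 0 (dist a b), ∀ t ∈ Set.Icc 0 (dist a b), dist (γ s) (γ t) = |s - t|) ∧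
      S = γ '' Set.Icc 0 (dist a b) := by
  obtain ⟨l, γ, hl, h0, h1, hγ, rfl⟩ := h
  have hd : ∀ s ∈ Set.Icc 0 l, ∀ t ∈ Set.Icc 0 l, dist (γ s) (γ t) = |s - t| := by
    intro s hs t ht
    rw [dist_edist, hγ s hs t ht, ENNReal.toReal_ofReal (abs_nonneg _)]
  have hab : dist a b = l := by
    rw [← h0, ← h1, hd 0 ⟨le_rfl, hl⟩ l ⟨hl, le_rfl⟩, zero_sub, abs_neg, abs_of_nonneg hl]
  rw [hab]
  exact ⟨γ, h0, h1, hd, rfl⟩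

lemma IsGeodesicSegment.dist_add_dist {S : Set X} {a b m : X} (h : IsGeodesicSegment S a b)
    (hm : m ∈ S) : dist a m + dist m b = dist a b := by
  obtain ⟨γ, h0, h1, hd, rfl⟩ := h.exists_param
  obtain ⟨t, ht, rfl⟩ := hm
  have e1 := hd 0 ⟨le_rfl, dist_nonneg⟩ t ht
  have e2 := hd t ht _ ⟨dist_nonneg, le_rfl⟩
  rw [h0, zero_sub, abs_neg, abs_of_nonneg ht.1] at e1
  rw [h1, abs_sub_comm, abs_of_nonneg (sub_nonneg.2 ht.2)] at e2
  linarith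

lemma IsGeodesicSegment.dist_eq {S : Set X} {a b m n : X} (h : IsGeodesicSegment S a b)
    (hm : m ∈ S) (hn : n ∈ S) : dist m n = |dist a m - dist a n| := by
  obtain ⟨γ, h0, h1, hd, rfl⟩ := h.exists_param
  obtain ⟨s, hs, rfl⟩ := hm
  obtain ⟨t, ht, rfl⟩ := hn
  have e1 := hd 0 ⟨le_rfl, dist_nonneg⟩ s hs
  have e2 := hd 0 ⟨le_rfl, dist_nonneg⟩ t ht
  rw [h0, zero_sub, abs_neg, abs_of_nonneg hs.1] at e1
  rw [h0, zero_sub, abs_neg, abs_of_nonneg ht.1] at e2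
  rw [hd s hs t ht, e1, e2]

lemma IsGeodesicSegment.exists_dist_eq {S : Set X} {a b : X} (h : IsGeodesicSegment S a b)
    {s : ℝ} (h0s : 0 ≤ s) (hs : s ≤ dist a b) : ∃ m ∈ S, dist a m = s := by
  obtain ⟨γ, h0, h1, hd, rfl⟩ := h.exists_param
  refine ⟨γ s, ⟨s, ⟨h0s, hs⟩, rfl⟩, ?_⟩
  have e1 := hd 0 ⟨le_rfl, dist_nonneg⟩ s ⟨h0s, hs⟩
  rwa [h0, zero_sub, abs_neg, abs_of_nonneg h0s] at e1

/-- The infimum defining `cthickening` need not be attained; the extra `1` buys an actual nearby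
point. -/
lemma IsDeltaHyperbolic.exists_dist_le {δ : ℝ} (h : IsDeltaHyperbolic X δ) (hδ : 0 ≤ δ)
    {x y z p : X} {A B C : Set X} (hA : IsGeodesicSegment A x y) (hB : IsGeodesicSegment B y z)
    (hC : IsGeodesicSegment C z x) (hp : p ∈ A) : ∃ q ∈ B ∪ C, dist p q ≤ δ + 1 := by
  have h1 := Metric.cthickening_subset_thickening' (by linarith) (lt_add_one δ) _
    ((h x y z A B C hA hB hC).1 hp)
  obtain ⟨q, hq, hpq⟩ := Metric.mem_thickening_iff.1 h1
  exact ⟨q, hq, hpq.le⟩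

/-- In a hyperbolic space a point that is almost between `a` and `b` is close to each geodesic
that joins `a` and `b`. -/
lemma IsDeltaHyperbolic.exists_mem_dist_le_of_dist_add_dist_le {δ K : ℝ}
    (h : IsDeltaHyperbolic X δ) (hδ : 0 ≤ δ) {a b p : X} {A B C : Set X}
    (hA : IsGeodesicSegment A a b) (hB : IsGeodesicSegment B b p) (hC : IsGeodesicSegment C p a)
    (hp : dist a p + dist p b ≤ dist a b + K) : ∃ m ∈ A, dist p m ≤ 2 * (δ + 1) + K := by
  -- The candidate `m` is as far from `a` as `p` is, truncated at `b`. Its neighbor `q` on another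
  -- side has nearly the same distance as `m` to `b` or to `a`, and lies on a geodesic from there to
  -- `p`; this forces `dist p q ≤ δ + 1 + K`.
  obtain ⟨m, hm, hms⟩ := hA.exists_dist_eq (s := min (dist a p) (dist a b))
    (le_min dist_nonneg dist_nonneg) (min_le_right _ _)
  refine ⟨m, hm, ?_⟩
  have hadd := hA.dist_add_dist hm
  obtain ⟨q, hq, hmq⟩ := h.exists_dist_le hδ hA hB hC hm
  have t1 := dist_triangle p q m
  have t2 := dist_triangle a p b
  rw [dist_comm q m] at t1
  rcases hq with hq | hq
  · have e := hB.dist_add_dist hq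
    have t3 := dist_triangle m q b
    have := min_le_left (dist a p) (dist a b)
    rw [dist_comm q b] at t3
    rw [dist_comm p q, dist_comm p b] at *
    linarith
  · have e := hC.dist_add_dist hq
    have t3 := dist_triangle a q m
    have t4 : dist a p - K ≤ min (dist a p) (dist a b) := by
      have : 0 ≤ dist p b := dist_nonneg
      refine le_min ?_ ?_ <;> linarith
    rw [dist_comm q m, dist_comm a q] at t3
    rw [dist_comm p a] at e
    linarith

variable {f : Y → X} {K δ : ℝ}

/-- The image of a geodesic under a rough isometric embedding is close to each geodesic with
the same end points. -/
lemma IsDeltaHyperbolic.exists_dist_map_le (h : IsDeltaHyperbolic X δ) (hδ : 0 ≤ δ)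
    (hf : ∀ x y, |dist (f x) (f y) - dist x y| ≤ K)
    (hgeo : ∀ x y, ∃ S, IsGeodesicSegment S (f x) (f y)) {x y p : Y} {A : Set Y} {A' : Set X}
    (hA : IsGeodesicSegment A x y) (hA' : IsGeodesicSegment A' (f x) (f y)) (hp : p ∈ A) :
    ∃ m ∈ A', dist (f p) m ≤ 2 * (δ + 1) + 3 * K := by
  obtain ⟨B, hB⟩ := hgeo y p
  obtain ⟨C, hC⟩ := hgeo p x
  -- Each of the three distances among `x`, `p`, `y` changes by at most `K`, so `f p` is between the
  -- images up to `3 * K`.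
  refine h.exists_mem_dist_le_of_dist_add_dist_le hδ hA' hB hC ?_
  have e := hA.dist_add_dist hp
  have h1 := abs_le.1 (hf x p)
  have h2 := abs_le.1 (hf p y)
  have h3 := abs_le.1 (hf x y)
  linarith

/-- Each geodesic between images under a rough isometric embedding is close to the image of each
geodesic between the points themselves. -/
lemma IsDeltaHyperbolic.exists_mem_dist_map_le (h : IsDeltaHyperbolic X δ) (hδ : 0 ≤ δ)
    (hf : ∀ x y, |dist (f x) (f y) - dist x y| ≤ K)
    (hgeo : ∀ x y, ∃ S, IsGeodesicSegment S (f x) (f y)) {x y : Y} {m : X} {A : Set Y} {A' : Set X}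
    (hA : IsGeodesicSegment A x y) (hA' : IsGeodesicSegment A' (f x) (f y)) (hm : m ∈ A') :
    ∃ q ∈ A, dist (f q) m ≤ 4 * (δ + 1) + 8 * K := by
  -- Choose `q` at the distance from `x` that matches `m`. Then `f q` is within `2 * (δ + 1) + 3 *
  -- K` of some `n` on `A'`, and positions on `A'` are determined by the distance to `f x`, so `n`
  -- and `m` differ by at most that bound plus `2 * K`.
  obtain ⟨q, hq, hqs⟩ := hA.exists_dist_eq (s := min (dist (f x) m) (dist x y))
    (le_min dist_nonneg dist_nonneg) (min_le_right _ _)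
  obtain ⟨n, hn, hqn⟩ := h.exists_dist_map_le hδ hf hgeo hA hA' hq
  refine ⟨q, hq, ?_⟩
  have e1 := hA'.dist_eq hn hm
  have e2 := hA'.dist_add_dist hm
  have h1 := abs_le.1 (hf x q)
  have h2 := abs_le.1 (hf x y)
  have t1 := dist_triangle (f q) n m
  have t2 := abs_le.1 (abs_dist_sub_le (f q) n (f x))
  rw [dist_comm _ (f x), dist_comm _ (f x)] at t2
  have h3 := min_le_left (dist (f x) m) (dist x y)
  have h4 : dist (f x) m - K ≤ min (dist (f x) m) (dist x y) := by
    have : 0 ≤ dist m (f y) := dist_nonneg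
    refine le_min ?_ ?_ <;> linarith
  have h5 : |dist (f x) n - dist (f x) m| ≤ 2 * (δ + 1) + 3 * K + 2 * K :=
    abs_le.2 ⟨by linarith, by linarith⟩
  linarith

/-- Transfer a triangle to the target, use thinness there, and come back. Geodesics are required
only between image points, so that later only those between vertices have to be constructed. -/
lemma IsDeltaHyperbolic.of_rough_isometry (h : IsDeltaHyperbolic X δ) (hδ : 0 ≤ δ)
    (hf : ∀ x y, |dist (f x) (f y) - dist x y| ≤ K)
    (hgeo : ∀ x y, ∃ S, IsGeodesicSegment S (f x) (f y)) :
    IsDeltaHyperbolic Y (7 * (δ + 1) + 12 * K) := by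
  have key : ∀ (x y z : Y) (A B C : Set Y), IsGeodesicSegment A x y → IsGeodesicSegment B y z →
      IsGeodesicSegment C z x → A ⊆ Metric.cthickening (7 * (δ + 1) + 12 * K) (B ∪ C) := by
    intro x y z A B C hA hB hC p hp
    obtain ⟨A', hA'⟩ := hgeo x y
    obtain ⟨B', hB'⟩ := hgeo y z
    obtain ⟨C', hC'⟩ := hgeo z x
    obtain ⟨m, hm, hpm⟩ := h.exists_dist_map_le hδ hf hgeo hA hA' hp
    obtain ⟨n, hn, hmn⟩ := h.exists_dist_le hδ hA' hB' hC' hm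
    obtain ⟨q, hq, hqn⟩ : ∃ q ∈ B ∪ C, dist (f q) n ≤ 4 * (δ + 1) + 8 * K := by
      rcases hn with hn | hn
      · obtain ⟨q, hq, hqn⟩ := h.exists_mem_dist_map_le hδ hf hgeo hB hB' hn
        exact ⟨q, Or.inl hq, hqn⟩
      · obtain ⟨q, hq, hqn⟩ := h.exists_mem_dist_map_le hδ hf hgeo hC hC' hn
        exact ⟨q, Or.inr hq, hqn⟩
    -- The path `f p`, `m`, `n`, `f q` costs `2 * (δ + 1) + 3 * K`, `δ + 1` and `4 * (δ + 1) + 8 *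
    -- K`; the last `K` comes from replacing `dist (f p) (f q)` by `dist p q`.
    refine Metric.mem_cthickening_of_dist_le p q _ _ hq ?_
    have t1 := dist_triangle (f p) m (f q)
    have t2 := dist_triangle m n (f q)
    have t3 := abs_le.1 (hf p q)
    rw [dist_comm n] at t2
    linarith
  exact fun x y z A B C hA hB hC =>
    ⟨key x y z A B C hA hB hC, key y z x B C A hB hC hA, key z x y C A B hC hA hB⟩

end RoughIsometry

/-! ### Vertices and edge paths in metric graphs -/

namespace MetricGraph

variable {V : Type*} {G : SimpleGraph V}

/-- The vertex `u`, as a point of the metric graph. -/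
noncomputable def ofVertex (G : SimpleGraph V) (u : V) : MetricGraph G :=
  ⟨Finsupp.single u 1, u, u, Or.inl rfl, left_mem_segment ℝ _ _⟩

@[simp]
lemma coords_ofVertex_self (u : V) : (ofVertex G u).coords u = 1 := by simp [ofVertex]

lemma isEnd_ofVertex (u : V) : (ofVertex G u).IsEnd u :=
  ⟨u, Or.inl rfl, left_mem_segment ℝ _ _⟩

lemma edist_ofVertex_le_of_isEnd {x : MetricGraph G} {u : V} (h : x.IsEnd u) :
    edist x (ofVertex G u) ≤ ENNReal.ofReal (1 - x.coords u) := by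
  refine (min_le_right _ _).trans ((vertexDist_le h (isEnd_ofVertex u)).trans ?_)
  simp

lemma edist_ofVertex_le_one {x : MetricGraph G} {u : V} (h : x.IsEnd u) :
    edist x (ofVertex G u) ≤ 1 := by
  refine (edist_ofVertex_le_of_isEnd h).trans ?_
  rw [← ENNReal.ofReal_one]
  exact ENNReal.ofReal_le_ofReal (by linarith [x.coords_nonneg u])

lemma coords_ofVertex_of_ne {u v : V} (h : v ≠ u) : (ofVertex G u).coords v = 0 := by
  simp [ofVertex, h.symm]

-- A neighbor of a vertex also counts as an end of it, at cost one. Such detours do not shorten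
-- distances, by `IsEnd.edist_le`.
@[simp]
lemma edist_ofVertex (u v : V) : edist (ofVertex G u) (ofVertex G v) = G.edist u v := by
  refine le_antisymm ?_ (le_min ?_ ?_)
  · refine (min_le_right _ _).trans ((vertexDist_le (isEnd_ofVertex u) (isEnd_ofVertex v)).trans ?_)
    simp
  · refine le_iInf fun a => le_iInf fun b => le_iInf fun h => ?_
    by_cases huv : u = v
    · subst huv; simp
    have hu : u = a ∨ u = b := by
      by_contra! hc
      have := h.1.eq_zero hc.1 hc.2
      simp at this
    have hv : v = a ∨ v = b := by
      by_contra! hc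
      have := h.2.eq_zero hc.1 hc.2
      simp at this
    have hadj : a = b ∨ G.Adj a b := h.1.eq_or_adj
    have h1 : G.edist u v ≤ 1 := SimpleGraph.edist_le_one_iff_adj_or_eq.2 (by
      have := G.adj_comm a b
      grind)
    have h2 : (G.edist u v : ℝ≥0∞) ≤ 1 := by
      calc (G.edist u v : ℝ≥0∞) ≤ ((1 : ℕ∞) : ℝ≥0∞) := by exact_mod_cast h1
        _ = 1 := by simp
    refine h2.trans ?_
    have h3 : |(ofVertex G u).coords a - (ofVertex G v).coords a| = 1 := by
      by_cases hau : a = u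
      · subst hau
        rw [coords_ofVertex_self, coords_ofVertex_of_ne huv]
        norm_num
      · have hav : a = v := by grind
        subst hav
        rw [coords_ofVertex_self, coords_ofVertex_of_ne hau]
        norm_num
    rw [h3]
    simp
  · refine le_iInf fun a => le_iInf fun b => le_iInf fun h => ?_
    have h1 := (isEnd_ofVertex u).edist_le h.1
    have h2 := h.2.edist_le (isEnd_ofVertex v)
    rw [coords_ofVertex_self, sub_self, ENNReal.ofReal_zero, zero_add] at h1
    rw [coords_ofVertex_self, sub_self, ENNReal.ofReal_zero, add_zero] at h2
    have h3 : (G.edist u v : ℝ≥0∞) ≤ G.edist u a + G.edist a b + G.edist b v := by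
      exact_mod_cast SimpleGraph.edist_triangle.trans
        (add_le_add (SimpleGraph.edist_triangle (G := G)) le_rfl)
    exact h3.trans (by gcongr)

/-- A nonzero coordinate is what ties an end to the component of the point, since `component` only
constrains the support. -/
lemma exists_isEnd_coords_ne_zero (x : MetricGraph G) : ∃ u, x.IsEnd u ∧ x.coords u ≠ 0 := by
  obtain ⟨u, v, h⟩ := x.exists_mem_segment
  have h : x.OnEdge u v := h
  by_cases huv : u = v
  · subst huv
    exact ⟨u, h.isEnd, by rw [h.coords_self]; exact one_ne_zero⟩
  by_cases hu : x.coords u = 0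
  · have := h.add_eq huv
    exact ⟨v, h.symm.isEnd, by linarith⟩
  · exact ⟨u, h.isEnd, hu⟩

lemma ofVertex_mem_component {C : G.ConnectedComponent} {u : V}
    (h : G.connectedComponentMk u = C) : ofVertex G u ∈ component C := by
  intro v hv
  by_cases hvu : v = u
  · rwa [hvu]
  · exact absurd (coords_ofVertex_of_ne hvu) hv

/-- The ends of two points are at almost the same distance as the points. -/
lemma edist_le_edist_add_two {x y : MetricGraph G} {u v : V} (hu : x.IsEnd u) (hv : y.IsEnd v) :
    (G.edist u v : ℝ≥0∞) ≤ edist x y + 2 := by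
  rw [← edist_ofVertex (G := G)]
  calc _ ≤ edist (ofVertex G u) x + edist x y + edist y (ofVertex G v) := edist_triangle4 _ _ _ _
    _ ≤ 1 + edist x y + 1 := by
      rw [edist_comm (ofVertex G u)]
      exact add_le_add (add_le_add (edist_ofVertex_le_one hu) le_rfl) (edist_ofVertex_le_one hv)
    _ = edist x y + 2 := by rw [add_comm 1, add_assoc, one_add_one_eq_two]

lemma edist_le_add_two {x y : MetricGraph G} {u v : V} (hu : x.IsEnd u) (hv : y.IsEnd v) :
    edist x y ≤ (G.edist u v : ℝ≥0∞) + 2 := by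
  rw [← edist_ofVertex (G := G)]
  calc _ ≤ edist x (ofVertex G u) + edist (ofVertex G u) (ofVertex G v) + edist (ofVertex G v) y :=
        edist_triangle4 _ _ _ _
    _ ≤ 1 + edist (ofVertex G u) (ofVertex G v) + 1 := by
      rw [edist_comm (ofVertex G v) y]
      exact add_le_add (add_le_add (edist_ofVertex_le_one hu) le_rfl) (edist_ofVertex_le_one hv)
    _ = _ := by rw [add_comm 1, add_assoc, one_add_one_eq_two]

lemma edist_component_ne_top {C : G.ConnectedComponent} (x y : component C) :
    edist x y ≠ ⊤ := by
  obtain ⟨u, hu, hu0⟩ := exists_isEnd_coords_ne_zero x.1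
  obtain ⟨v, hv, hv0⟩ := exists_isEnd_coords_ne_zero y.1
  have hr : G.Reachable u v :=
    SimpleGraph.ConnectedComponent.exact ((x.2 u hu0).trans (y.2 v hv0).symm)
  have h1 : (G.edist u v : ℝ≥0∞) ≠ ⊤ := by
    simpa using SimpleGraph.edist_ne_top_iff_reachable.2 hr
  exact ne_top_of_le_ne_top (ENNReal.add_ne_top.2 ⟨h1, by simp⟩) (edist_le_add_two hu hv)

/-- `getVert` is constant past the end of the walk; the degenerate edge permitted there lets
`walkPoint` be defined at all times. -/
lemma getVert_eq_or_adj {u v : V} (w : G.Walk u v) (k : ℕ) :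
    w.getVert k = w.getVert (k + 1) ∨ G.Adj (w.getVert k) (w.getVert (k + 1)) := by
  rcases lt_or_ge k w.length with h | h
  · exact Or.inr (w.adj_getVert_succ h)
  · left
    rw [w.getVert_of_length_le h, w.getVert_of_length_le (h.trans (Nat.le_succ k))]

lemma edist_getVert_add_le {u v : V} (w : G.Walk u v) (i k : ℕ) :
    G.edist (w.getVert i) (w.getVert (i + k)) ≤ k := by
  induction k with
  | zero => simp
  | succ k ih =>
    refine SimpleGraph.edist_triangle.trans ((add_le_add ih
      (SimpleGraph.edist_le_one_iff_adj_or_eq.2 (getVert_eq_or_adj w (i + k)).symm)).trans ?_)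
    simp

/-- The point that a walk of unit speed along `w` reaches at time `t`. -/
noncomputable def walkPoint {u v : V} (w : G.Walk u v) (t : ℝ) : MetricGraph G :=
  ⟨Finsupp.single (w.getVert ⌊t⌋₊) (1 - Int.fract t) +
      Finsupp.single (w.getVert (⌊t⌋₊ + 1)) (Int.fract t),
    w.getVert ⌊t⌋₊, w.getVert (⌊t⌋₊ + 1), getVert_eq_or_adj w _,
    1 - Int.fract t, Int.fract t, by linarith [Int.fract_lt_one t], Int.fract_nonneg t, by ring,
    by simp⟩

variable {u v : V} (w : G.Walk u v)

lemma onEdge_walkPoint (t : ℝ) :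
    (walkPoint w t).OnEdge (w.getVert ⌊t⌋₊) (w.getVert (⌊t⌋₊ + 1)) :=
  ⟨getVert_eq_or_adj w _, 1 - Int.fract t, Int.fract t, by linarith [Int.fract_lt_one t],
    Int.fract_nonneg t, by ring, by simp [walkPoint]⟩

lemma coords_walkPoint_left (t : ℝ) (h : w.getVert ⌊t⌋₊ ≠ w.getVert (⌊t⌋₊ + 1)) :
    (walkPoint w t).coords (w.getVert ⌊t⌋₊) = 1 - Int.fract t := by
  simp [walkPoint, h.symm]

lemma le_coords_walkPoint_left (t : ℝ) :
    1 - Int.fract t ≤ (walkPoint w t).coords (w.getVert ⌊t⌋₊) := by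
  classical
  have := Int.fract_nonneg t
  simp only [walkPoint, Finsupp.add_apply, Finsupp.single_apply]
  split_ifs <;> simp_all

lemma le_coords_walkPoint_right (t : ℝ) :
    Int.fract t ≤ (walkPoint w t).coords (w.getVert (⌊t⌋₊ + 1)) := by
  classical
  have := Int.fract_lt_one t
  simp only [walkPoint, Finsupp.add_apply, Finsupp.single_apply]
  split_ifs <;> simp_all [this.le]

lemma walkPoint_natCast (n : ℕ) : walkPoint w n = ofVertex G (w.getVert n) := by
  ext a
  simp [walkPoint, ofVertex]

lemma edist_walkPoint_le {s t : ℝ} (hs : 0 ≤ s) (hst : s ≤ t) :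
    edist (walkPoint w s) (walkPoint w t) ≤ ENNReal.ofReal (t - s) := by
  have fs : Int.fract s = s - ⌊s⌋₊ := by
    rw [Int.fract, ← natCast_floor_eq_intCast_floor hs]
  have ft : Int.fract t = t - ⌊t⌋₊ := by
    rw [Int.fract, ← natCast_floor_eq_intCast_floor (hs.trans hst)]
  -- With equal floors both points lie on one edge. Otherwise the route passes through the vertex
  -- after `s` and the vertex before `t`, which are at most `⌊t⌋₊ - ⌊s⌋₊ - 1` edges apart.
  rcases (Nat.floor_mono hst).eq_or_lt with h | h
  · refine (min_le_left _ _).trans ((edgeDist_le (onEdge_walkPoint w s)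
      (h ▸ onEdge_walkPoint w t)).trans (ENNReal.ofReal_le_ofReal ?_))
    by_cases he : w.getVert ⌊s⌋₊ = w.getVert (⌊s⌋₊ + 1)
    · have h1 := onEdge_walkPoint w s
      have h2 := onEdge_walkPoint w t
      rw [← he] at h1
      rw [← h, ← he] at h2
      rw [h1.coords_self, h2.coords_self]
      simpa using hst
    · have h2 := coords_walkPoint_left w t (h ▸ he)
      rw [← h] at h2
      rw [coords_walkPoint_left w s he, h2, fs, ft, h,
        show 1 - (s - (⌊t⌋₊ : ℝ)) - (1 - (t - ⌊t⌋₊)) = t - s by ring,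
        abs_of_nonneg (sub_nonneg.2 hst)]
  · refine (min_le_right _ _).trans ((vertexDist_le (onEdge_walkPoint w s).symm.isEnd
      (onEdge_walkPoint w t).isEnd).trans ?_)
    obtain ⟨k, hk⟩ := Nat.exists_eq_add_of_lt h
    have hk' : ⌊t⌋₊ = ⌊s⌋₊ + 1 + k := by omega
    have h1 : (G.edist (w.getVert (⌊s⌋₊ + 1)) (w.getVert ⌊t⌋₊) : ℝ≥0∞) ≤ ENNReal.ofReal k := by
      rw [hk', ENNReal.ofReal_natCast]
      exact_mod_cast edist_getVert_add_le w (⌊s⌋₊ + 1) k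
    have h2 : (⌊t⌋₊ : ℝ) = ⌊s⌋₊ + 1 + k := by exact_mod_cast hk'
    have h3 := Int.fract_lt_one s
    have h4 := Int.fract_nonneg t
    calc _ ≤ ENNReal.ofReal (1 - Int.fract s) + ENNReal.ofReal k + ENNReal.ofReal (Int.fract t) := by
          refine add_le_add (add_le_add (ENNReal.ofReal_le_ofReal ?_) h1)
            (ENNReal.ofReal_le_ofReal ?_)
          · linarith [le_coords_walkPoint_right w s]
          · linarith [le_coords_walkPoint_left w t]
      _ = ENNReal.ofReal (t - s) := by
          rw [← ENNReal.ofReal_add (by linarith) (by positivity),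
            ← ENNReal.ofReal_add (by have := Nat.cast_nonneg (α := ℝ) k; linarith) h4]
          congr 1
          linarith

/-- A 1-Lipschitz path whose end points are as far apart as its length is a geodesic: a shortfall on
`[s, t]` would contradict the triangle inequality for the whole path. -/
lemma edist_walkPoint_of_length_eq (hw : (w.length : ℕ∞) = G.edist u v) {s t : ℝ} (hs : 0 ≤ s)
    (hst : s ≤ t) (ht : t ≤ w.length) :
    edist (walkPoint w s) (walkPoint w t) = ENNReal.ofReal (t - s) := by
  refine le_antisymm (edist_walkPoint_le w hs hst) ?_
  have h1 := edist_walkPoint_le w le_rfl hs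
  have h2 := edist_walkPoint_le w (hs.trans hst) ht
  have h3 := edist_triangle4 (walkPoint w 0) (walkPoint w s) (walkPoint w t) (walkPoint w w.length)
  have h4 : edist (walkPoint w 0) (walkPoint w w.length) = ENNReal.ofReal w.length := by
    rw [← Nat.cast_zero, walkPoint_natCast, walkPoint_natCast, edist_ofVertex, w.getVert_zero,
      w.getVert_length, ← hw, ENNReal.ofReal_natCast]
    simp
  rw [h4] at h3
  have hd : edist (walkPoint w s) (walkPoint w t) ≠ ⊤ :=
    ne_top_of_le_ne_top ENNReal.ofReal_ne_top (edist_walkPoint_le w hs hst)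
  have h5 := h3.trans (add_le_add (add_le_add h1 le_rfl) h2)
  rw [← ENNReal.ofReal_toReal hd] at h5 ⊢
  have hn : 0 ≤ (edist (walkPoint w s) (walkPoint w t)).toReal := ENNReal.toReal_nonneg
  rw [← ENNReal.ofReal_add (by linarith) hn, ← ENNReal.ofReal_add (by linarith) (by linarith),
    ENNReal.ofReal_le_ofReal_iff (by linarith)] at h5
  exact ENNReal.ofReal_le_ofReal (by linarith)

lemma walkPoint_mem_component {C : G.ConnectedComponent} (hu : G.connectedComponentMk u = C)
    (t : ℝ) : walkPoint w t ∈ component C := by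
  intro a ha
  have h : a = w.getVert ⌊t⌋₊ ∨ a = w.getVert (⌊t⌋₊ + 1) := by
    by_contra! hc
    exact ha ((onEdge_walkPoint w t).eq_zero hc.1 hc.2)
  rw [← hu]
  rcases h with rfl | rfl
  · exact (SimpleGraph.ConnectedComponent.sound (w.take _).reachable).symm
  · exact (SimpleGraph.ConnectedComponent.sound (w.take _).reachable).symm

lemma exists_isGeodesicSegment_ofVertex {C : G.ConnectedComponent}
    (hu : G.connectedComponentMk u = C) (hv : G.connectedComponentMk v = C) :
    ∃ S, IsGeodesicSegment S (⟨ofVertex G u, ofVertex_mem_component hu⟩ : component C)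
      ⟨ofVertex G v, ofVertex_mem_component hv⟩ := by
  have hr : G.Reachable u v := SimpleGraph.ConnectedComponent.exact (hu.trans hv.symm)
  obtain ⟨w, hw⟩ := hr.exists_walk_length_eq_edist
  refine ⟨_, w.length, fun t => ⟨walkPoint w t, walkPoint_mem_component w hu t⟩,
    Nat.cast_nonneg _, ?_, ?_, ?_, rfl⟩
  · refine Subtype.ext ?_
    change walkPoint w 0 = _
    rw [← Nat.cast_zero, walkPoint_natCast, w.getVert_zero]
  · refine Subtype.ext ?_
    change walkPoint w w.length = _
    rw [walkPoint_natCast, w.getVert_length]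
  · intro s hs t ht
    rw [Subtype.edist_eq]
    rcases le_total s t with h | h
    · rw [abs_sub_comm, abs_of_nonneg (sub_nonneg.2 h)]
      exact edist_walkPoint_of_length_eq w hw hs.1 h ht.2
    · rw [abs_of_nonneg (sub_nonneg.2 h), edist_comm]
      exact edist_walkPoint_of_length_eq w hw ht.1 h hs.2

end MetricGraph

/-! ### Hyperbolicity of components and maps of vertices -/

namespace MetricGraph

variable {V W : Type*} {G : SimpleGraph V} {H : SimpleGraph W}

/-- Send each point to one of its ends and then apply `φ`. Moving two points to ends costs at most
one each, which turns `K` into `K + 2`. -/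
lemma isDeltaHyperbolic_component_of_vertexMap {C : G.ConnectedComponent}
    {D : H.ConnectedComponent} {δ : ℝ} (hδ : 0 ≤ δ) (hD : IsDeltaHyperbolic (component D) δ)
    (K : ℕ) (φ : V → W)
    (hφ : ∀ u, G.connectedComponentMk u = C → H.connectedComponentMk (φ u) = D)
    (h₁ : ∀ u v, G.connectedComponentMk u = C → G.connectedComponentMk v = C →
      H.edist (φ u) (φ v) ≤ G.edist u v + K)
    (h₂ : ∀ u v, G.connectedComponentMk u = C → G.connectedComponentMk v = C →
      G.edist u v ≤ H.edist (φ u) (φ v) + K) :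
    IsDeltaHyperbolic (component C) (7 * (δ + 1) + 12 * (K + 2)) := by
  have hend : ∀ x : component C, ∃ u, x.1.IsEnd u ∧ G.connectedComponentMk u = C := fun x => by
    obtain ⟨u, hu, hu0⟩ := exists_isEnd_coords_ne_zero x.1
    exact ⟨u, hu, x.2 u hu0⟩
  choose r hr hrC using hend
  let f : component C → component D := fun x =>
    ⟨ofVertex H (φ (r x)), ofVertex_mem_component (hφ _ (hrC x))⟩
  have hfd : ∀ x y, edist (f x) (f y) = (H.edist (φ (r x)) (φ (r y)) : ℝ≥0∞) := fun x y =>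
    edist_ofVertex _ _
  have hK : ENNReal.ofReal (K + 2) = K + 2 := by
    rw [ENNReal.ofReal_add (by positivity) (by positivity)]
    simp
  have hf₁ : ∀ x y, edist (f x) (f y) ≤ edist x y + ENNReal.ofReal (K + 2) := fun x y => by
    have e1 : (H.edist (φ (r x)) (φ (r y)) : ℝ≥0∞) ≤ G.edist (r x) (r y) + K := by
      exact_mod_cast h₁ _ _ (hrC x) (hrC y)
    have e2 : (G.edist (r x) (r y) : ℝ≥0∞) ≤ edist x y + 2 := edist_le_edist_add_two (hr x) (hr y)
    rw [hfd, hK]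
    refine e1.trans ((add_le_add e2 le_rfl).trans (le_of_eq ?_))
    ring
  have hf₂ : ∀ x y, edist x y ≤ edist (f x) (f y) + ENNReal.ofReal (K + 2) := fun x y => by
    have e1 : (G.edist (r x) (r y) : ℝ≥0∞) ≤ H.edist (φ (r x)) (φ (r y)) + K := by
      exact_mod_cast h₂ _ _ (hrC x) (hrC y)
    have e2 : edist x y ≤ (G.edist (r x) (r y) : ℝ≥0∞) + 2 := edist_le_add_two (hr x) (hr y)
    rw [hfd, hK, ← add_assoc]
    exact e2.trans (add_le_add e1 le_rfl)
  have hgeo : ∀ x y, ∃ S, IsGeodesicSegment S (f x) (f y) := fun x y =>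
    exists_isGeodesicSegment_ofVertex (hφ _ (hrC x)) (hφ _ (hrC y))
  have toReal_le : ∀ a b : ℝ≥0∞, b ≠ ⊤ → a ≤ b + ENNReal.ofReal (K + 2) →
      a.toReal ≤ b.toReal + (K + 2) := fun a b hb h => by
    have := ENNReal.toReal_mono (ENNReal.add_ne_top.2 ⟨hb, ENNReal.ofReal_ne_top⟩) h
    rwa [ENNReal.toReal_add hb ENNReal.ofReal_ne_top, ENNReal.toReal_ofReal (by positivity)] at this
  -- Distances within a component are finite, so both components become pseudometric spaces with
  -- unchanged `edist`, and `hD` still applies.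
  let _ : PseudoMetricSpace (component C) :=
    PseudoEMetricSpace.toPseudoMetricSpace edist_component_ne_top
  let _ : PseudoMetricSpace (component D) :=
    PseudoEMetricSpace.toPseudoMetricSpace edist_component_ne_top
  refine IsDeltaHyperbolic.of_rough_isometry (f := f) hD hδ (fun x y => ?_) hgeo
  have d1 := toReal_le _ _ (edist_component_ne_top x y) (hf₁ x y)
  have d2 := toReal_le _ _ (edist_component_ne_top (f x) (f y)) (hf₂ x y)
  exact abs_le.2 ⟨by change _ ≤ (edist _ _).toReal - (edist _ _).toReal; linarith,
    by change (edist _ _).toReal - (edist _ _).toReal ≤ _; linarith⟩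

end MetricGraph

/-! ### Distances, components and hyperbolicity of direct products -/

namespace SimpleGraph

variable {V W : Type*} {G : SimpleGraph V} {H : SimpleGraph W}

lemma edist_map_le (φ : G →g H) (u v : V) : H.edist (φ u) (φ v) ≤ G.edist u v := by
  refine le_iInf fun w => ?_
  rw [← Walk.length_map φ w]
  exact edist_le _

/-- The projection of a direct product to the first factor. -/
def directProduct.fst (G : SimpleGraph V) (H : SimpleGraph W) : G.directProduct H →g G where
  toFun := Prod.fst
  map_rel' h := h.1

/-- A two-colored graph, mapped to its direct product with an edge of another graph. -/
def directProduct.liftLeft (c : G.Coloring Bool) {v v' : W} (h : H.Adj v v') :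
    G →g G.directProduct H where
  toFun u := (u, bif c u then v else v')
  map_rel' {a b} hab := by
    have := c.valid hab
    refine ⟨hab, ?_⟩
    cases ha : c a <;> cases hb : c b <;> simp_all [h.symm]

lemma directProduct.liftLeft_apply (c : G.Coloring Bool) {v v' : W} (h : H.Adj v v') (u : V) :
    liftLeft c h u = (u, bif c u then v else v') := rfl

/-- A two-colored graph, mapped to the direct product of an edge of another graph with it. -/
def directProduct.liftRight (d : H.Coloring Bool) {u u' : V} (h : G.Adj u u') :
    H →g G.directProduct H where
  toFun v := (bif d v then u else u', v)
  map_rel' {a b} hab := by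
    have := d.valid hab
    refine ⟨?_, hab⟩
    cases ha : d a <;> cases hb : d b <;> simp_all [h.symm]

lemma directProduct.liftRight_apply (d : H.Coloring Bool) {u u' : V} (h : G.Adj u u') (v : W) :
    liftRight d h v = (bif d v then u else u', v) := rfl

/-- The first coordinate moves to `u'` while the second alternates between `v` and `b`, stopping at
`w`. By `hcd`, `w` has the color of `v'`, so the second coordinate can then move to `v'` while the
first alternates between `u'` and `a` and ends at `u'`. -/
lemma exists_edist_directProduct_le (c : G.Coloring Bool) (d : H.Coloring Bool) {u u' a : V}
    {v v' b : W} (ha : G.Adj u' a) (hb : H.Adj v b) (hcd : (c u ^^ d v) = (c u' ^^ d v')) :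
    ∃ w, (G.directProduct H).edist (u, v) (u', v') ≤ G.edist u u' + H.edist w v' := by
  obtain ⟨w, hw, hw'⟩ : ∃ w, (G.directProduct H).edist (u, v) (u', w) ≤ G.edist u u' ∧
      d w = d v' := by
    have hvb := d.valid hb
    -- The color of `u` decides the orientation of the edge `vb` for which the lift starts at `(u,
    -- v)`.
    cases hu : c u
    · refine ⟨bif c u' then b else v, ?_, ?_⟩
      · simpa [directProduct.liftLeft_apply, hu] using
          edist_map_le (directProduct.liftLeft c hb.symm) u u'
      · cases hu' : c u' <;> simp_all
    · refine ⟨bif c u' then v else b, ?_, ?_⟩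
      · simpa [directProduct.liftLeft_apply, hu] using edist_map_le (directProduct.liftLeft c hb) u u'
      · cases hu' : c u' <;> simp_all
  refine ⟨w, SimpleGraph.edist_triangle.trans (add_le_add hw ?_)⟩
  cases hv' : d v'
  · simpa [directProduct.liftRight_apply, hw', hv'] using
      edist_map_le (directProduct.liftRight d ha.symm) w v'
  · simpa [directProduct.liftRight_apply, hw', hv'] using edist_map_le (directProduct.liftRight d ha) w v'

lemma Reachable.xor_coloring_eq (c : G.Coloring Bool) (d : H.Coloring Bool) {x y : V × W}
    (h : (G.directProduct H).Reachable x y) : (c x.1 ^^ d x.2) = (c y.1 ^^ d y.2) := by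
  obtain ⟨p⟩ := h
  induction p with
  | nil => rfl
  | cons h _ ih =>
    rw [← ih]
    have h1 := c.valid h.1
    have h2 := d.valid h.2
    have key : ∀ i j k l : Bool, i ≠ k → j ≠ l → (i ^^ j) = (k ^^ l) := by decide
    exact key _ _ _ _ h1 h2

lemma reachable_directProduct_iff [Nontrivial V] [Nontrivial W] (hG : G.Connected)
    (hH : H.Connected) (c : G.Coloring Bool) (d : H.Coloring Bool) {x y : V × W} :
    (G.directProduct H).Reachable x y ↔ (c x.1 ^^ d x.2) = (c y.1 ^^ d y.2) := by
  refine ⟨Reachable.xor_coloring_eq c d, fun h => ?_⟩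
  obtain ⟨a, ha⟩ := hG.preconnected.exists_adj_of_nontrivial y.1
  obtain ⟨b, hb⟩ := hH.preconnected.exists_adj_of_nontrivial x.2
  obtain ⟨w, hw⟩ := exists_edist_directProduct_le c d ha hb h
  refine reachable_of_edist_ne_top (ne_top_of_le_ne_top ?_ hw)
  have h1 := edist_ne_top_iff_reachable.2 (hG x.1 y.1)
  have h2 := edist_ne_top_iff_reachable.2 (hH w y.2)
  simp [h1, h2]

lemma card_connectedComponent_directProduct [Nontrivial V] [Nontrivial W] (hG : G.Connected)
    (hH : H.Connected) (c : G.Coloring Bool) (d : H.Coloring Bool) :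
    Nat.card (G.directProduct H).ConnectedComponent = 2 := by
  let F : (G.directProduct H).ConnectedComponent → Bool :=
    ConnectedComponent.lift (fun x => c x.1 ^^ d x.2)
      (fun _ _ p _ => Reachable.xor_coloring_eq c d p.reachable)
  have hF : Function.Bijective F := by
    constructor
    · refine ConnectedComponent.ind₂ fun x y h => ?_
      exact ConnectedComponent.sound ((reachable_directProduct_iff hG hH c d).2 h)
    · intro b
      obtain ⟨u⟩ := hG.nonempty
      obtain ⟨v⟩ := hH.nonempty
      obtain ⟨v', hv⟩ := hH.preconnected.exists_adj_of_nontrivial v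
      have h := d.valid hv
      -- Replacing `v` by a neighbor flips the invariant, so both values occur.
      by_cases hb : (c u ^^ d v) = b
      · exact ⟨(G.directProduct H).connectedComponentMk (u, v), hb⟩
      · refine ⟨(G.directProduct H).connectedComponentMk (u, v'), ?_⟩
        have key : ∀ i j k l : Bool, j ≠ k → (i ^^ j) ≠ l → (i ^^ k) = l := by decide
        exact key _ _ _ _ h hb
  rw [Nat.card_congr (Equiv.ofBijective F hF)]
  simp

lemma IsBoundedGraph.exists_edist_le (hG : G.IsBoundedGraph) : ∃ K : ℕ, ∀ u v, G.edist u v ≤ K := by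
  obtain ⟨K, hK⟩ := ENNReal.exists_nat_gt hG.ne
  refine ⟨K, fun u v => ?_⟩
  have h : (G.edist u v : ℝ≥0∞) ≤ K := by
    rw [← MetricGraph.edist_ofVertex (G := G)]
    exact (Metric.edist_le_ediam_of_mem (Set.mem_univ _) (Set.mem_univ _)).trans hK.le
  exact_mod_cast h

lemma IsHyperbolic.directProduct (h : G.IsHyperbolic) (hG : G.Connected) [Nontrivial W]
    (hH : H.Connected) (c : G.Coloring Bool) (d : H.Coloring Bool) (hb : H.IsBoundedGraph) :
    (G.directProduct H).IsHyperbolic := by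
  obtain ⟨δ, hδ, h⟩ := h
  obtain ⟨K, hK⟩ := hb.exists_edist_le
  refine ⟨7 * (δ + 1) + 12 * (K + 2), by positivity, fun C => ?_⟩
  obtain ⟨u₀⟩ := hG.nonempty
  refine MetricGraph.isDeltaHyperbolic_component_of_vertexMap hδ (h (G.connectedComponentMk u₀)) K
    Prod.fst (fun x _ => ConnectedComponent.sound (hG _ _))
    (fun x y _ _ => (edist_map_le (directProduct.fst G H) x y).trans le_self_add)
    (fun x y hx hy => ?_)
  have hxy : (G.directProduct H).Reachable x y := ConnectedComponent.exact (hx.trans hy.symm)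
  rcases subsingleton_or_nontrivial V with hV | hV
  -- Over a single vertex the product has no edges, so reachable vertices coincide.
  · obtain ⟨p⟩ := hxy
    cases p with
    | nil => simp
    | cons h _ => exact absurd (Subsingleton.elim _ _) h.1.ne
  · obtain ⟨a, ha⟩ := hG.preconnected.exists_adj_of_nontrivial y.1
    obtain ⟨b, hb⟩ := hH.preconnected.exists_adj_of_nontrivial x.2
    obtain ⟨w, hw⟩ := exists_edist_directProduct_le c d ha hb (hxy.xor_coloring_eq c d)
    exact hw.trans (add_le_add le_rfl (hK _ _))

/-- The lift along the edge `vv'` and the projection are both homomorphisms, hence do not increase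
distances, and their composite is the identity of `G`. So the lift is isometric on vertices and the
error is `0`. -/
lemma IsHyperbolic.of_directProduct (h : (G.directProduct H).IsHyperbolic) (hG : G.Connected)
    {v v' : W} (hv : H.Adj v v') (c : G.Coloring Bool) : G.IsHyperbolic := by
  obtain ⟨δ, hδ, h⟩ := h
  refine ⟨7 * (δ + 1) + 12 * ((0 : ℕ) + 2), by positivity, fun C => ?_⟩
  obtain ⟨u₀⟩ := hG.nonempty
  refine MetricGraph.isDeltaHyperbolic_component_of_vertexMap hδ
    (h ((G.directProduct H).connectedComponentMk (directProduct.liftLeft c hv u₀))) 0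
    (directProduct.liftLeft c hv)
    (fun x _ => ConnectedComponent.sound ((hG x u₀).map _))
    (fun x y _ _ => (edist_map_le (directProduct.liftLeft c hv) x y).trans le_self_add)
    (fun x y _ _ => (edist_map_le (directProduct.fst G H) _ _).trans le_self_add)

end SimpleGraph

theorem mainTheorem3 {V₁ V₂ : Type*} (G₁ : SimpleGraph V₁) (G₂ : SimpleGraph V₂)
    (hG₁ : G₁.Connected) (hG₂ : G₂.Connected) (hodd₁ : G₁.NoOddCycle) (hodd₂ : G₂.NoOddCycle)
    (hnt₂ : Nontrivial V₂) (hbdd₂ : G₂.IsBoundedGraph) :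
    (Nontrivial V₁ → Nat.card (G₁.directProduct G₂).ConnectedComponent = 2) ∧
      ((G₁.directProduct G₂).IsHyperbolic ↔ G₁.IsHyperbolic) := by
  obtain ⟨c⟩ := hodd₁.exists_coloring
  obtain ⟨d⟩ := hodd₂.exists_coloring
  obtain ⟨v⟩ := hG₂.nonempty
  obtain ⟨v', hv⟩ := hG₂.preconnected.exists_adj_of_nontrivial v
  exact ⟨fun _ => SimpleGraph.card_connectedComponent_directProduct hG₁ hG₂ c d,
    fun h => h.of_directProduct hG₁ hv c, fun h => h.directProduct hG₁ hG₂ c d hbdd₂⟩
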